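/- Let $\overline{\mathbb Q}\subset\mathbb C$ be the field of algebraic numbers and $\mathcal U(\overline{\mathbb Q})=\{z\in\overline{\mathbb Q}:|z|=1\}$. An algebraic multiplier on a (discrete) group $G$ is a normalized 2-cocycle with values in $\mathcal U(\overline{\mathbb Q})$, i.e. a map $\sigma\colon G\times G\to\mathcal U(\overline{\mathbb Q})$ such that $\sigma(b,c)\sigma(a,bc)=\sigma(ab,c)\sigma(a,b)$ and $\sigma(1,g)=\sigma(g,1)=1$ for all $a,b,c,g\in G$. The twisted group algebra $\overline{\mathbb Q}(G,\sigma)$ consists of the finite sums $\sum_g a_g g$ with $a_g\in\overline{\mathbb Q}$, with product $\big(\sum_g a_g g\big)\big(\sum_h b_h h\big)=\sum_{g,h}a_g b_h\,\sigma(g,h)\,gh$. A matrix $A\in M_d(\overline{\mathbb Q}(G,\sigma))$ acts on $l^2(G)^d$ by twisted left multiplication, $$(Af)(x)=\sum_{g\in G}A(g)\,\sigma(g,g^{-1}x)\,f(g^{-1}x),$$ where $A(g)\in M_d(\overline{\mathbb Q})$ is the matrix of coefficients of $g$ in $A$. The group $G$ has the $\sigma$-multiplier algebraic eigenvalue property if,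 for every $d$ and every $A\in M_d(\overline{\mathbb Q}(G,\sigma))$, all eigenvalues of $A$ on $l^2(G)^d$ are algebraic numbers. It has the algebraic eigenvalue property if this holds for $\sigma\equiv 1$, that is, for all matrices over the ordinary group algebra $\overline{\mathbb Q}G$. **Theorem.** Let $$1\to H\to G\xrightarrow{\;p\;}G/H\to 1$$ be a short exact sequence of groups in which the quotient $G/H$ is finitely generated and amenable. Let $\sigma'$ be an algebraic multiplier on $G/H$, and let $\sigma=p^*\sigma'$, $\sigma(g,h)=\sigma'(p(g),p(h))$, be its pullback to $G$. If $H$ has the algebraic eigenvalue property, then $G$ has the $\sigma$-multiplier algebraic eigenvalue property. -/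

import Mathlib

open scoped ENNReal Pointwise

/-- A discrete group is amenable if it carries a left-invariant finitely additive probability
measure defined on all of its subsets. -/
def IsAmenableGroup (G : Type*) [Group G] : Prop :=
  ∃ m : Set G → ℝ≥0∞, m Set.univ = 1 ∧
    (∀ s t : Set G, Disjoint s t → m (s ∪ t) = m s + m t) ∧
    ∀ (g : G) (s : Set G), m (g • s) = m s

/-- The field of algebraic numbers, as a subfield of `ℂ`. -/
noncomputable abbrev algebraicNumbers : Subfield ℂ := (algebraicClosure ℚ ℂ).toSubfield

/-- A multiplier on `G` with values in the unitary elements `U(K) = K ∩ U(1)` of a subfield `K`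
of `ℂ`: a normalized 2-cocycle `G × G → U(K)` (for the trivial action). -/
structure Multiplier (K : Subfield ℂ) (G : Type*) [Group G] where
  toFun : G → G → K
  norm_eq_one : ∀ g h, ‖(toFun g h : ℂ)‖ = 1
  cocycle : ∀ a b c, toFun b c * toFun a (b * c) = toFun (a * b) c * toFun a b
  one_left : ∀ g, toFun 1 g = 1
  one_right : ∀ g, toFun g 1 = 1

namespace Multiplier

instance (K : Subfield ℂ) (G : Type*) [Group G] :
    CoeFun (Multiplier K G) (fun _ => G → G → K) := ⟨toFun⟩

/-- The identity multiplier. -/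
noncomputable def trivial (K : Subfield ℂ) (G : Type*) [Group G] : Multiplier K G where
  toFun _ _ := 1
  norm_eq_one _ _ := by simp
  cocycle _ _ _ := rfl
  one_left _ := rfl
  one_right _ := rfl

/-- The pullback `p^* σ` of a multiplier along a group homomorphism `p`. -/
def pullback {K : Subfield ℂ} {G Q : Type*} [Group G] [Group Q]
    (p : G →* Q) (σ : Multiplier K Q) : Multiplier K G where
  toFun g h := σ (p g) (p h)
  norm_eq_one _ _ := σ.norm_eq_one _ _
  cocycle a b c := by simpa using σ.cocycle (p a) (p b) (p c)
  one_left g := by simpa using σ.one_left (p g)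
  one_right g := by simpa using σ.one_right (p g)

end Multiplier

/-- The twisted group algebra `K(G,σ)`: finite formal sums `∑ a_g g` with `a_g ∈ K`. -/
def TwistedGroupAlgebra {K : Subfield ℂ} {G : Type*} [Group G] (_σ : Multiplier K G) : Type _ :=
  G →₀ K

namespace TwistedGroupAlgebra

variable {K : Subfield ℂ} {G : Type*} [Group G] {σ : Multiplier K G}

noncomputable instance : AddCommGroup (TwistedGroupAlgebra σ) :=
  inferInstanceAs (AddCommGroup (G →₀ K))

/-- The element `x g` of `K(G,σ)`, for `g ∈ G` and `x ∈ K`. -/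
noncomputable def single (σ : Multiplier K G) (g : G) : K →+ TwistedGroupAlgebra σ :=
  Finsupp.singleAddHom g

/-- The twisted product `(∑ a_g g)(∑ b_h h) = ∑ a_g b_h σ(g,h) gh`, as a biadditive map. -/
noncomputable def mulHom (σ : Multiplier K G) : (G →₀ K) →+ (G →₀ K) →+ (G →₀ K) :=
  Finsupp.liftAddHom fun g =>
    { toFun := fun x => Finsupp.liftAddHom fun h =>
        (Finsupp.singleAddHom (g * h)).comp (AddMonoidHom.mulLeft (x * σ g h))
      map_zero' := by
        refine Finsupp.addHom_ext fun h y => ?_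
        simp
      map_add' := fun x x' => by
        refine Finsupp.addHom_ext fun h y => ?_
        simp [add_mul] }

noncomputable instance : Mul (TwistedGroupAlgebra σ) := ⟨fun a b => (mulHom σ a b : G →₀ K)⟩

noncomputable instance : One (TwistedGroupAlgebra σ) := ⟨single σ 1 1⟩

theorem single_mul_single (g h : G) (x y : K) :
    single σ g x * single σ h y = single σ (g * h) (x * σ g h * y) := by
  change mulHom σ (Finsupp.single g x) (Finsupp.single h y) =
    Finsupp.single (g * h) (x * σ g h * y)
  simp [mulHom]

@[elab_as_elim]
theorem induction {P : TwistedGroupAlgebra σ → Prop} (a : TwistedGroupAlgebra σ)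
    (zero : P 0) (add : ∀ a b, P a → P b → P (a + b)) (single : ∀ g x, P (single σ g x)) : P a :=
  Finsupp.induction_linear a zero (fun a b => add a b) single

noncomputable instance : NonUnitalNonAssocRing (TwistedGroupAlgebra σ) where
  left_distrib a b c := map_add (mulHom σ a) b c
  right_distrib a b c := DFunLike.congr_fun (map_add (mulHom σ) (a : G →₀ K) b) c
  zero_mul a := DFunLike.congr_fun (map_zero (mulHom σ)) a
  mul_zero a := map_zero (mulHom σ a)

noncomputable instance : Ring (TwistedGroupAlgebra σ) where
  __ := (inferInstance : NonUnitalNonAssocRing (TwistedGroupAlgebra σ))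
  mul_assoc a b c := by
    induction a using TwistedGroupAlgebra.induction with
    | zero => simp
    | add a a' ha ha' => simp only [add_mul, ha, ha']
    | single g x =>
      induction b using TwistedGroupAlgebra.induction with
      | zero => simp
      | add b b' hb hb' => simp only [add_mul, mul_add, hb, hb']
      | single h y =>
        induction c using TwistedGroupAlgebra.induction with
        | zero => simp
        | add c c' hc hc' => simp only [mul_add, hc, hc']
        | single k z =>
          simp only [single_mul_single, mul_assoc g h k]
          congr 1
          linear_combination (-(x * y * z)) * σ.cocycle g h k
  one_mul a := by
    change single σ 1 1 * a = a
    induction a using TwistedGroupAlgebra.induction with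
    | zero => simp
    | add a a' ha ha' => simp only [mul_add, ha, ha']
    | single g x => simp [single_mul_single, σ.one_left]
  mul_one a := by
    change a * single σ 1 1 = a
    induction a using TwistedGroupAlgebra.induction with
    | zero => simp
    | add a a' ha ha' => simp only [add_mul, ha, ha']
    | single g x => simp [single_mul_single, σ.one_right]

end TwistedGroupAlgebra

/-- The Hilbert space `l²(G)`. -/
abbrev ellTwo (G : Type*) : Type _ := lp (fun _ : G => ℂ) 2

/-- The Hilbert space `l²(G)^d`. -/
abbrev ellTwoPow (G : Type*) (d : ℕ) : Type _ := PiLp 2 (fun _ : Fin d => ellTwo G)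

theorem ellTwo_memℓp_of_norm_eq {G : Type*} (e : G ≃ G) (f : ellTwo G) (u : G → ℂ)
    (hu : ∀ x, ‖u x‖ = ‖f (e x)‖) : Memℓp u 2 := by
  have h := (memℓp_gen_iff (p := 2) (by norm_num)).1 (lp.memℓp f)
  rw [memℓp_gen_iff (by norm_num)]
  simp only [hu]
  exact h.comp_injective e.injective

/-- The left magnetic translation `(L_g f)(x) = σ(g, g⁻¹x) f(g⁻¹x)` on `l²(G)`. -/
noncomputable def leftTranslation {K : Subfield ℂ} {G : Type*} [Group G] (σ : Multiplier K G)
    (g : G) : ellTwo G →ₗᵢ[ℂ] ellTwo G where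
  toFun f := ⟨fun x => (σ g (g⁻¹ * x) : ℂ) * f (g⁻¹ * x),
    ellTwo_memℓp_of_norm_eq (Equiv.mulLeft g⁻¹) f _ fun x => by simp [σ.norm_eq_one]⟩
  map_add' f f' := by
    ext x
    exact mul_add _ _ _
  map_smul' c f := by
    ext x
    exact mul_left_comm _ _ _
  norm_map' f := by
    have h : (0 : ℝ) < (2 : ℝ≥0∞).toReal := by norm_num
    rw [← Real.rpow_left_inj (norm_nonneg _) (norm_nonneg _) h.ne', lp.norm_rpow_eq_tsum h,
      lp.norm_rpow_eq_tsum h, ← (Equiv.mulLeft g⁻¹).tsum_eq fun x => ‖f x‖ ^ (2 : ℝ≥0∞).toReal]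
    refine tsum_congr fun x => ?_
    simp [σ.norm_eq_one]

/-- The left twisted multiplication operator `∑ a_g L_g` on `l²(G)` of `a = ∑ a_g g ∈ K(G,σ)`. -/
noncomputable def TwistedGroupAlgebra.toOperator {K : Subfield ℂ} {G : Type*} [Group G]
    {σ : Multiplier K G} (a : TwistedGroupAlgebra σ) : ellTwo G →L[ℂ] ellTwo G :=
  Finsupp.sum (M := K) a fun g c => (c : ℂ) • (leftTranslation σ g).toContinuousLinearMap

/-- The operator on `l²(G)^d` of a `d × d` matrix over `K(G,σ)`:
`(A f)_i = ∑ j, A i j · f_j`. -/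
noncomputable def matrixOperator {K : Subfield ℂ} {G : Type*} [Group G] {σ : Multiplier K G}
    {d : ℕ} (A : Matrix (Fin d) (Fin d) (TwistedGroupAlgebra σ)) :
    ellTwoPow G d →L[ℂ] ellTwoPow G d :=
  (PiLp.continuousLinearEquiv 2 ℂ (fun _ : Fin d => ellTwo G)).symm.toContinuousLinearMap ∘L
    ContinuousLinearMap.pi fun i =>
      ∑ j, (A i j).toOperator ∘L PiLp.proj 2 (fun _ : Fin d => ellTwo G) j

/-- The `σ`-multiplier algebraic eigenvalue property, for an algebraic multiplier `σ` on `G`: for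
every square matrix over the `σ`-twisted group algebra with algebraic coefficients, all the
eigenvalues of its operator on `l²(G)^d` are algebraic numbers. -/
def HasMultiplierAlgebraicEigenvalueProperty {G : Type*} [Group G]
    (σ : Multiplier algebraicNumbers G) : Prop :=
  ∀ (d : ℕ) (A : Matrix (Fin d) (Fin d) (TwistedGroupAlgebra σ)) (z : ℂ),
    Module.End.HasEigenvalue (matrixOperator A : Module.End ℂ (ellTwoPow G d)) z →
      IsAlgebraic ℚ z

/-- The (untwisted) algebraic eigenvalue property: the twisted group algebra of the identity
multiplier is the ordinary group algebra. -/
def HasAlgebraicEigenvalueProperty (G : Type*) [Group G] : Prop :=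
  HasMultiplierAlgebraicEigenvalueProperty (Multiplier.trivial algebraicNumbers G)

/-! ### The trace on operators commuting with projective translations -/

section OrbitTrace

open Filter Topology ContinuousLinearMap

local notation "⟪" x ", " y "⟫" => inner ℂ x y

variable {G ι E : Type*} [NormedAddCommGroup E] [InnerProductSpace ℂ E]

/-! Suppose that a transcendental `z` is an eigenvalue of `A`. The operator `D = A - z` commutes
with the right magnetic translations, so its kernel has a von Neumann dimension `t`, the sum of `‖P
δ_(j,1)‖²` with `P` the projection onto the kernel, and `t > 0`. The plan is to compare `D` with
operators over `H` by cutting `G` along a finite set `X` of cosets.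

Since the multiplier comes from the quotient, it is constant along cosets of `H`. Compressing `A` to
the cosets over `X` therefore gives a matrix `B` over the ordinary group algebra of `H`, and `D' = B
- z` is injective by the hypothesis on `H`. For `f` in `ker D`, the restriction of `f` to these
cosets is mapped by `D'` to a vector supported over the boundary `Y` of `X`. The space of all
vectors with this property has dimension `|Y| d` over `H` (`sum_norm_sq_ker_coordProj_mul`), because
an injective invariant operator has injective adjoint (`ker_adjoint_eq_bot`). Comparison of
dimensions (`norm_starProjection_adjoint_le`) gives `|X| t ≤ |Y| d`, which fails for a Følner set
with small enough boundary (`IsAmenableGroup.exists_foelner`).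

The equality of the dimensions of `ker C` and `ker C*` needs no polar decomposition: both
projections are ergodic limits of polynomials in `C*C` and `CC*`, whose traces agree. -/

theorem ker_smul_eq {C : E →L[ℂ] E} {c : ℂ} (hc : c ≠ 0) : (c • C).ker = C.ker := by
  ext v
  simp [hc]

theorem inner_starProjection_self (K : Submodule ℂ E) [K.HasOrthogonalProjection] (v : E) :
    ⟪v, K.starProjection v⟫ = ((‖K.starProjection v‖ ^ 2 : ℝ) : ℂ) := by
  have h := Submodule.starProjection_inner_eq_zero (K := K) v _ (K.starProjection_apply_mem v)
  rw [inner_sub_left, sub_eq_zero] at h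
  rw [h, inner_self_eq_norm_sq_to_K]
  norm_cast

variable [CompleteSpace E]

/-- The algebra of the operators commuting with a family of unitaries. -/
noncomputable def unitaryCommutant (R : G → E ≃ₗᵢ[ℂ] E) : StarSubalgebra ℂ (E →L[ℂ] E) :=
  StarSubalgebra.centralizer ℂ (Set.range fun g => ((R g : E ≃L[ℂ] E) : E →L[ℂ] E))

/-- The adjoint of a unitary is its inverse, so commuting with `R g` already implies commuting with
its adjoint. -/
theorem mem_unitaryCommutant_iff {R : G → E ≃ₗᵢ[ℂ] E} {S : E →L[ℂ] E} :
    S ∈ unitaryCommutant R ↔ ∀ g v, S (R g v) = R g (S v) := by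
  have hadj : ∀ g, star ((R g : E ≃L[ℂ] E) : E →L[ℂ] E) = ((R g).symm : E ≃L[ℂ] E) := fun g =>
    LinearIsometryEquiv.adjoint_eq_symm (R g)
  simp only [unitaryCommutant, StarSubalgebra.mem_centralizer_iff, Set.forall_mem_range]
  constructor
  · intro h g v
    exact (DFunLike.congr_fun (h g).1 v).symm
  · intro h g
    refine ⟨ContinuousLinearMap.ext fun v => (h g v).symm, ?_⟩
    rw [hadj]
    refine ContinuousLinearMap.ext fun v => (R g).injective ?_
    have := h g ((R g).symm v)
    simp only [LinearIsometryEquiv.apply_symm_apply] at this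
    change R g ((R g).symm (S v)) = R g (S ((R g).symm v))
    rw [LinearIsometryEquiv.apply_symm_apply, this]

theorem adjoint_mem_unitaryCommutant {R : G → E ≃ₗᵢ[ℂ] E} {S : E →L[ℂ] E}
    (hS : S ∈ unitaryCommutant R) : adjoint S ∈ unitaryCommutant R :=
  star_mem hS

theorem norm_one_sub_adjoint_mul_self_le {C : E →L[ℂ] E} (hC : ‖C‖ ≤ 1) :
    ‖1 - adjoint C * C‖ ≤ 1 := by
  refine opNorm_le_bound _ zero_le_one fun v => ?_
  rw [one_mul]
  refine le_of_sq_le_sq ?_ (norm_nonneg v)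
  have h1 : ‖adjoint C (C v)‖ ≤ ‖C v‖ := by
    refine (le_opNorm _ _).trans ?_
    rw [LinearIsometryEquiv.norm_map]
    exact mul_le_of_le_one_left (norm_nonneg _) hC
  have h2 : RCLike.re ⟪v, adjoint C (C v)⟫ = ‖C v‖ ^ 2 := by
    rw [adjoint_inner_right, inner_self_eq_norm_sq]
  change ‖v - adjoint C (C v)‖ ^ 2 ≤ ‖v‖ ^ 2
  rw [norm_sub_sq (𝕜 := ℂ), h2]
  nlinarith [norm_nonneg (adjoint C (C v)), norm_nonneg (C v)]

/-- This is von Neumann's mean ergodic theorem for the contraction `1 - C*C`, whose fixed vectors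
form `ker C*C = ker C`. -/
theorem tendsto_average_ker_starProjection {C : E →L[ℂ] E} (hC : ‖C‖ ≤ 1) (v : E) :
    Tendsto (fun N : ℕ => (N : ℂ)⁻¹ • ∑ k ∈ Finset.range N, ((1 - adjoint C * C) ^ k) v) atTop
      (𝓝 (C.ker.starProjection v)) := by
  have hker : (1 - adjoint C * C).eqLocus (1 : E →L[ℂ] E) = C.ker := by
    ext v
    simp only [LinearMap.mem_eqLocus, LinearMap.mem_ker]
    change v - adjoint C (C v) = v ↔ C v = 0
    rw [sub_eq_self]
    refine ⟨fun h => ?_, fun h => by simp [h]⟩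
    rw [← inner_self_eq_zero (𝕜 := ℂ), ← adjoint_inner_right, h, inner_zero_right]
  have h := tendsto_birkhoffAverage_orthogonalProjection _ (norm_one_sub_adjoint_mul_self_le hC) v
  have hproj : ((((1 - adjoint C * C).eqLocus (1 : E →L[ℂ] E)).orthogonalProjectionOnto v :
      (1 - adjoint C * C).eqLocus (1 : E →L[ℂ] E)) : E) = C.ker.starProjection v := by
    rw [Submodule.coe_orthogonalProjectionOnto_apply]
    congr! 2
  rw [hproj] at h
  refine h.congr fun N => ?_
  simp [birkhoffAverage, birkhoffSum]

/-- Rescaling makes the ergodic theorem applicable and leaves the kernel unchanged. -/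
theorem exists_smul_contraction (C : E →L[ℂ] E) : ∃ c : ℂ, c ≠ 0 ∧ ‖c • C‖ ≤ 1 := by
  have h : 0 < ‖C‖ + 1 := by positivity
  refine ⟨((‖C‖ + 1 : ℝ) : ℂ)⁻¹, by exact_mod_cast (inv_pos.2 h).ne', ?_⟩
  rw [norm_smul, norm_inv, Complex.norm_real, Real.norm_of_nonneg h.le, inv_mul_le_iff₀ h]
  linarith

theorem ker_starProjection_mem_unitaryCommutant {R : G → E ≃ₗᵢ[ℂ] E} {C : E →L[ℂ] E}
    (hC : C ∈ unitaryCommutant R) :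
    C.ker.starProjection ∈ unitaryCommutant R := by
  obtain ⟨c, hc, hn⟩ := exists_smul_contraction C
  have hC' : c • C ∈ unitaryCommutant R := SMulMemClass.smul_mem c hC
  have hk := ker_smul_eq (C := C) hc
  generalize c • C = D at *
  simp only [← hk]
  have hU : ∀ k : ℕ, (1 - adjoint D * D) ^ k ∈ unitaryCommutant R := fun k =>
    pow_mem (sub_mem (one_mem _) (mul_mem (adjoint_mem_unitaryCommutant hC') hC')) k
  refine mem_unitaryCommutant_iff.2 fun g v => ?_
  refine tendsto_nhds_unique (tendsto_average_ker_starProjection hn (R g v)) ?_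
  have := ((R g).continuous.tendsto _).comp (tendsto_average_ker_starProjection hn v)
  refine this.congr fun N => ?_
  simp only [Function.comp_apply, map_smul, map_sum, mem_unitaryCommutant_iff.1 (hU _)]

variable [Group G]

/-- The unitaries `R g` translate the Hilbert basis `b` from the right, up to phases. -/
def IsProjectiveTranslation (b : HilbertBasis (ι × G) ℂ E) (R : G → E ≃ₗᵢ[ℂ] E) : Prop :=
  ∀ k j h, ∃ c : ℂ, ‖c‖ = 1 ∧ R k (b (j, h)) = c • b (j, h * k⁻¹)

variable {b : HilbertBasis (ι × G) ℂ E} {R : G → E ≃ₗᵢ[ℂ] E}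

theorem norm_apply_translate (hb : IsProjectiveTranslation b R) {S : E →L[ℂ] E}
    (hS : S ∈ unitaryCommutant R) (j : ι) (g : G) : ‖S (b (j, g))‖ = ‖S (b (j, 1))‖ := by
  obtain ⟨c, hc, h⟩ := hb g j g
  rw [← (R g).norm_map, ← mem_unitaryCommutant_iff.1 hS, h, map_smul, norm_smul, hc, one_mul,
    mul_inv_cancel]

/-- Each phase of the projective translation occurs once together with its conjugate, so all phases
cancel in the product. -/
theorem inner_mul_inner_translate (hb : IsProjectiveTranslation b R) {S T : E →L[ℂ] E}
    (hS : S ∈ unitaryCommutant R) (hT : T ∈ unitaryCommutant R) (j l : ι) (g h k : G) :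
    ⟪b (j, g), S (b (l, h))⟫ * ⟪b (l, h), T (b (j, g))⟫ =
      ⟪b (j, g * k⁻¹), S (b (l, h * k⁻¹))⟫ * ⟪b (l, h * k⁻¹), T (b (j, g * k⁻¹))⟫ := by
  obtain ⟨c, hc, h1⟩ := hb k j g
  obtain ⟨c', hc', h2⟩ := hb k l h
  rw [← (R k).inner_map_map (b (j, g)), ← (R k).inner_map_map (b (l, h)),
    ← mem_unitaryCommutant_iff.1 hS, ← mem_unitaryCommutant_iff.1 hT, h1, h2]
  simp only [map_smul, inner_smul_left, inner_smul_right]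
  have e1 : (starRingEnd ℂ) c * c = 1 := by rw [Complex.conj_mul', hc]; norm_num
  have e2 : (starRingEnd ℂ) c' * c' = 1 := by rw [Complex.conj_mul', hc']; norm_num
  linear_combination (⟪b (j, g * k⁻¹), S (b (l, h * k⁻¹))⟫ *
    ⟪b (l, h * k⁻¹), T (b (j, g * k⁻¹))⟫) * (((starRingEnd ℂ) c' * c') * e1 + e2)

variable [Fintype ι]

/-- The sum of the diagonal matrix coefficients over representatives of the orbits. -/
noncomputable def orbitTrace (b : HilbertBasis (ι × G) ℂ E) (S : E →L[ℂ] E) : ℂ :=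
  ∑ j, ⟪b (j, 1), S (b (j, 1))⟫

theorem orbitTrace_sub (S T : E →L[ℂ] E) :
    orbitTrace b (S - T) = orbitTrace b S - orbitTrace b T := by
  simp [orbitTrace]

theorem orbitTrace_mul (S T : E →L[ℂ] E) :
    orbitTrace b (S * T) =
      ∑ j, ∑ l, ∑' h, ⟪b (j, 1), S (b (l, h))⟫ * ⟪b (l, h), T (b (j, 1))⟫ := by
  refine Finset.sum_congr rfl fun j _ => ?_
  have hs := b.hasSum_inner_mul_inner (adjoint S (b (j, 1))) (T (b (j, 1)))
  simp only [adjoint_inner_left] at hs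
  change ⟪b (j, 1), S (T (b (j, 1)))⟫ = _
  rw [← hs.tsum_eq, hs.summable.tsum_prod, tsum_fintype]

/-- In the Parseval expansion of both sides, translating the pair `(1, h⁻¹)` by `h⁻¹` turns it into
`(h, 1)`; inversion in the summation index then matches the two sums. -/
theorem orbitTrace_mul_comm (hb : IsProjectiveTranslation b R) {S T : E →L[ℂ] E}
    (hS : S ∈ unitaryCommutant R) (hT : T ∈ unitaryCommutant R) :
    orbitTrace b (S * T) = orbitTrace b (T * S) := by
  rw [orbitTrace_mul, orbitTrace_mul, Finset.sum_comm]
  refine Finset.sum_congr rfl fun l _ => Finset.sum_congr rfl fun j _ => ?_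
  rw [← (Equiv.inv G).tsum_eq]
  refine tsum_congr fun h => ?_
  rw [inner_mul_inner_translate hb hS hT j l 1 _ h⁻¹, mul_comm]
  simp

theorem tendsto_orbitTrace_average {C : E →L[ℂ] E} (hC : ‖C‖ ≤ 1) :
    Tendsto (fun N : ℕ => (N : ℂ)⁻¹ *
      ∑ k ∈ Finset.range N, orbitTrace b ((1 - adjoint C * C) ^ k)) atTop
      (𝓝 (orbitTrace b C.ker.starProjection)) := by
  have h : Tendsto (fun N : ℕ => ∑ j, ⟪b (j, 1), (N : ℂ)⁻¹ •
      ∑ k ∈ Finset.range N, ((1 - adjoint C * C) ^ k) (b (j, 1))⟫) atTop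
      (𝓝 (orbitTrace b C.ker.starProjection)) :=
    tendsto_finsetSum _ fun j _ => tendsto_const_nhds.inner (tendsto_average_ker_starProjection hC _)
  refine h.congr fun N => ?_
  simp only [inner_smul_right, inner_sum, orbitTrace]
  rw [← Finset.mul_sum, Finset.sum_comm]

/-- By traciality `(1 - ST)^k S · T` has the trace of `T (1 - ST)^k S`, and `T` intertwines `1 - ST`
with `1 - TS`. -/
theorem orbitTrace_pow_one_sub (hb : IsProjectiveTranslation b R) {S T : E →L[ℂ] E}
    (hS : S ∈ unitaryCommutant R) (hT : T ∈ unitaryCommutant R) (k : ℕ) :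
    orbitTrace b ((1 - S * T) ^ k) = orbitTrace b ((1 - T * S) ^ k) := by
  induction k with
  | zero => simp
  | succ k ih =>
    have hcomm : T * (1 - S * T) ^ k = (1 - T * S) ^ k * T := by
      have : SemiconjBy T (1 - S * T) (1 - T * S) := by
        simp [SemiconjBy, mul_sub, sub_mul, mul_assoc]
      exact (this.pow_right k).eq
    have hU : (1 - S * T) ^ k ∈ unitaryCommutant R :=
      pow_mem (sub_mem (one_mem _) (mul_mem hS hT)) k
    rw [pow_succ, pow_succ, mul_sub, mul_sub, orbitTrace_sub, orbitTrace_sub, mul_one, mul_one, ih,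
      ← mul_assoc, orbitTrace_mul_comm hb (mul_mem hU hS) hT, ← mul_assoc, hcomm, mul_assoc]

/-- The trace of the projection onto the kernel is the same for an operator and its adjoint. -/
theorem orbitTrace_ker_adjoint (hb : IsProjectiveTranslation b R) {C : E →L[ℂ] E}
    (hC : C ∈ unitaryCommutant R) :
    orbitTrace b (adjoint C).ker.starProjection = orbitTrace b C.ker.starProjection := by
  obtain ⟨c, hc, hn⟩ := exists_smul_contraction C
  have hC' : c • C ∈ unitaryCommutant R := SMulMemClass.smul_mem c hC
  have hk := ker_smul_eq (C := C) hc
  have hk' : (adjoint (c • C)).ker = (adjoint C).ker := by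
    rw [map_smulₛₗ]
    exact ker_smul_eq (by simpa using hc)
  generalize c • C = D at *
  simp only [← hk, ← hk']
  have hn' : ‖adjoint D‖ ≤ 1 := by rwa [LinearIsometryEquiv.norm_map]
  refine tendsto_nhds_unique (tendsto_orbitTrace_average hn') ?_
  refine (tendsto_orbitTrace_average hn).congr fun N => ?_
  rw [adjoint_adjoint]
  congr 1
  exact Finset.sum_congr rfl fun k _ =>
    orbitTrace_pow_one_sub hb (adjoint_mem_unitaryCommutant hC') hC' k

theorem orbitTrace_starProjection (K : Submodule ℂ E) [K.HasOrthogonalProjection] :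
    orbitTrace b K.starProjection = ((∑ j, ‖K.starProjection (b (j, 1))‖ ^ 2 : ℝ) : ℂ) := by
  simp only [orbitTrace, inner_starProjection_self, Complex.ofReal_sum]

/-- Faithfulness of the trace: `‖S (b (j, g))‖` does not depend on `g`, so `S` vanishes on the whole
basis. -/
theorem eq_zero_of_sum_norm_sq_eq_zero (hb : IsProjectiveTranslation b R) {S : E →L[ℂ] E}
    (hS : S ∈ unitaryCommutant R) (h : ∑ j, ‖S (b (j, 1))‖ ^ 2 = 0) : S = 0 := by
  have h0 := (Finset.sum_eq_zero_iff_of_nonneg fun j _ => by positivity).1 h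
  refine ContinuousLinearMap.ext_on (s := Set.range b)
    (Submodule.dense_iff_topologicalClosure_eq_top.2 b.dense_span) ?_
  rintro _ ⟨⟨j, g⟩, rfl⟩
  rw [zero_apply, ← norm_eq_zero, norm_apply_translate hb hS]
  simpa using h0 j (Finset.mem_univ j)

theorem ker_eq_bot_iff_sum_norm_sq (hb : IsProjectiveTranslation b R) {C : E →L[ℂ] E}
    (hC : C ∈ unitaryCommutant R) :
    C.ker = ⊥ ↔ ∑ j, ‖C.ker.starProjection (b (j, 1))‖ ^ 2 = 0 := by
  constructor
  · intro h
    refine Finset.sum_eq_zero fun j _ => ?_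
    have := Submodule.starProjection_apply_mem C.ker (b (j, 1))
    have h0 := (Submodule.eq_bot_iff _).1 h _ this
    rw [h0]
    simp
  · intro h
    have := eq_zero_of_sum_norm_sq_eq_zero hb (ker_starProjection_mem_unitaryCommutant hC) h
    rw [eq_bot_iff]
    intro v hv
    rw [Submodule.mem_bot, ← (Submodule.starProjection_eq_self_iff (K := C.ker)).2 hv, this,
      zero_apply]

theorem sum_norm_sq_ker_adjoint (hb : IsProjectiveTranslation b R) {C : E →L[ℂ] E}
    (hC : C ∈ unitaryCommutant R) :
    ∑ j, ‖(adjoint C).ker.starProjection (b (j, 1))‖ ^ 2 =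
      ∑ j, ‖C.ker.starProjection (b (j, 1))‖ ^ 2 := by
  have := orbitTrace_ker_adjoint hb hC
  rw [orbitTrace_starProjection, orbitTrace_starProjection] at this
  exact_mod_cast this

/-- The finiteness property: both kernels have the same dimension, and dimension zero detects a
trivial kernel. -/
theorem ker_adjoint_eq_bot (hb : IsProjectiveTranslation b R) {C : E →L[ℂ] E}
    (hC : C ∈ unitaryCommutant R) (h : C.ker = ⊥) : (adjoint C).ker = ⊥ := by
  rw [ker_eq_bot_iff_sum_norm_sq hb (adjoint_mem_unitaryCommutant hC),
    sum_norm_sq_ker_adjoint hb hC, ← ker_eq_bot_iff_sum_norm_sq hb hC, h]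

end OrbitTrace

/-! ### Følner sets from an invariant mean -/

section Foelner

variable {Q : Type*} [Group Q]

/-- A finite set which doubles the size of all finite sets under multiplication from the left
yields a paradoxical decomposition, so it does not exist in an amenable group. -/
theorem IsAmenableGroup.exists_card_mul_lt [DecidableEq Q] (h : IsAmenableGroup Q)
    (S : Finset Q) : ∃ X : Finset Q, (S * X).card < 2 * X.card := by
  classical
  by_contra! hS
  obtain ⟨m, hm1, hadd, hinv⟩ := h
  have hm0 : m ∅ = 0 := by
    have := hadd Set.univ ∅ (Set.disjoint_empty _)
    rw [Set.union_empty, hm1] at this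
    exact (ENNReal.add_right_inj ENNReal.one_ne_top).1 (by rw [← this, add_zero])
  have hmono : ∀ s, m s ≤ 1 := fun s => by
    rw [← hm1, ← Set.union_compl_self s, hadd _ _ disjoint_compl_right]
    exact le_self_add
  have hsum : ∀ (I : Finset (Q × Bool)) (A : Q × Bool → Set Q),
      (∀ i ∈ I, ∀ j ∈ I, i ≠ j → Disjoint (A i) (A j)) →
      m (⋃ i ∈ I, A i) = ∑ i ∈ I, m (A i) := by
    intro I A
    induction I using Finset.induction_on with
    | empty => simp [hm0]
    | insert a I ha ih =>
      intro hd
      rw [Finset.set_biUnion_insert, Finset.sum_insert ha, hadd, ih]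
      · exact fun i hi j hj => hd i (Finset.mem_insert_of_mem hi) j (Finset.mem_insert_of_mem hj)
      · refine Set.disjoint_iUnion₂_right.2 fun i hi => ?_
        exact hd a (Finset.mem_insert_self _ _) i (Finset.mem_insert_of_mem hi)
          (fun h => ha (h ▸ hi))
  -- The doubling assumption is Hall's condition for two copies of `Q`, so the marriage theorem
  -- gives an injection `φ` of `Q × Bool` into `Q` with `φ (q, β) ∈ S q`.
  obtain ⟨φ, hφ, hφS⟩ := (Finset.all_card_le_biUnion_card_iff_exists_injective
    (fun q : Q × Bool => S * {q.1})).1 (by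
      intro s
      have h1 : s.card ≤ 2 * (s.image Prod.fst).card := by
        calc s.card ≤ ((s.image Prod.fst) ×ˢ (Finset.univ : Finset Bool)).card :=
              Finset.card_le_card fun q hq => by
                simp only [Finset.mem_product, Finset.mem_univ, and_true]
                exact Finset.mem_image_of_mem _ hq
          _ = _ := by simp [mul_comm]
      refine (h1.trans (hS _)).trans (Finset.card_le_card fun x hx => ?_)
      obtain ⟨a, ha, y, hy, rfl⟩ := Finset.mem_mul.1 hx
      obtain ⟨q, hq, rfl⟩ := Finset.mem_image.1 hy
      exact Finset.mem_biUnion.2 ⟨q, hq, Finset.mul_mem_mul ha (Finset.mem_singleton_self _)⟩)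
  -- On the piece with index `(s, β)` the map `φ (·, β)` is left translation by `s`. For each `β`
  -- the pieces partition `Q`, while by injectivity of `φ` all translated pieces are disjoint;
  -- invariance of the mean then yields `2 ≤ 1`.
  let A : Q × Bool → Set Q := fun i => {q | φ (q, i.2) = i.1 * q}
  have hcover : ∀ β : Bool, ∑ s ∈ S, m (A (s, β)) = 1 := by
    intro β
    have := hsum (S ×ˢ {β}) A (by
      rintro ⟨s, x⟩ hs ⟨t, y⟩ ht hst
      simp only [Finset.mem_product, Finset.mem_singleton] at hs ht
      obtain ⟨-, rfl⟩ := hs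
      obtain ⟨-, rfl⟩ := ht
      refine Set.disjoint_left.2 fun q h1 h2 => hst ?_
      have h1 : φ (q, y) = s * q := h1
      have h2 : φ (q, y) = t * q := h2
      rw [mul_right_cancel (h1.symm.trans h2)])
    rw [Finset.sum_product] at this
    simp only [Finset.sum_singleton] at this
    rw [← this, ← hm1]
    congr 1
    refine Set.eq_univ_of_forall fun q => ?_
    obtain ⟨s, hs, y, hy, hsy⟩ := Finset.mem_mul.1 (hφS (q, β))
    rw [Finset.mem_singleton.1 hy] at hsy
    exact Set.mem_iUnion₂.2 ⟨(s, β), by simp [hs], hsy.symm⟩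
  have hpack := hsum (S ×ˢ Finset.univ) (fun i => i.1 • A i) (by
    rintro ⟨s, x⟩ - ⟨t, y⟩ - hst
    refine Set.disjoint_left.2 fun q h1 h2 => hst ?_
    obtain ⟨a, ha, rfl⟩ := h1
    obtain ⟨b, hb, hab⟩ := h2
    have ha : φ (a, x) = s * a := ha
    have hb : φ (b, y) = t * b := hb
    have hab : t * b = s * a := hab
    have := hφ (ha.trans (hab.symm.trans hb.symm))
    simp only [Prod.mk.injEq] at this
    obtain ⟨rfl, rfl⟩ := this
    have hts : t = s := mul_right_cancel hab
    rw [hts])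
  have hle := hmono (⋃ i ∈ S ×ˢ (Finset.univ : Finset Bool), i.1 • A i)
  rw [hpack] at hle
  simp only [hinv] at hle
  rw [Finset.sum_product_right] at hle
  simp only [hcover] at hle
  norm_num at hle

/-- The left Følner condition, in terms of the boundary relative to a finite set `S`. -/
theorem IsAmenableGroup.exists_foelner [DecidableEq Q] (h : IsAmenableGroup Q) (S : Finset Q)
    {ε : ℝ} (hε : 0 < ε) :
    ∃ X : Finset Q, ((X.filter fun x => ∃ s ∈ S, s⁻¹ * x ∉ X).card : ℝ) < ε * X.card := by
  by_contra! hX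
  -- A boundary point is `s` times a point of `WX \ X`, so a boundary of size at least `ε |X|`
  -- forces `|WX \ X| ≥ δ |X|`. The `+ 1` keeps the denominator positive when `S` is empty.
  set δ : ℝ := ε / (S.card + 1) with hδdef
  have hδ : 0 < δ := by positivity
  set W : Finset Q := insert 1 S⁻¹ with hW
  have hgrow : ∀ X : Finset Q, (1 + δ) * X.card ≤ (W * X).card := by
    intro X
    have h1 : (X.filter fun x => ∃ s ∈ S, s⁻¹ * x ∉ X) ⊆ S * ((W * X) \ X) := by
      intro x hx
      obtain ⟨hxX, s, hs, hsx⟩ := Finset.mem_filter.1 hx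
      refine Finset.mem_mul.2 ⟨s, hs, s⁻¹ * x, Finset.mem_sdiff.2 ⟨?_, hsx⟩, by simp⟩
      exact Finset.mul_mem_mul (Finset.mem_insert_of_mem (Finset.inv_mem_inv hs)) hxX
    have hsub : X ⊆ W * X := fun x hx =>
      Finset.mem_mul.2 ⟨1, Finset.mem_insert_self _ _, x, hx, one_mul x⟩
    have h2 : ((X.filter fun x => ∃ s ∈ S, s⁻¹ * x ∉ X).card : ℝ) ≤
        S.card * ((W * X) \ X).card := by
      exact_mod_cast (Finset.card_le_card h1).trans Finset.card_mul_le
    have h3 : (((W * X) \ X).card : ℝ) = (W * X).card - X.card := by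
      rw [Finset.card_sdiff_of_subset hsub, Nat.cast_sub (Finset.card_le_card hsub)]
    have h4 := (hX X).trans h2
    have h5 : δ * X.card ≤ ((W * X) \ X).card := by
      rw [hδdef, div_mul_eq_mul_div, div_le_iff₀ (by positivity)]
      nlinarith [Nat.cast_nonneg (α := ℝ) ((W * X) \ X).card]
    rw [h3] at h5
    linarith
  have hpow : ∀ (k : ℕ) (X : Finset Q), (1 + δ) ^ k * X.card ≤ (W ^ k * X).card := by
    intro k
    induction k with
    | zero => simp
    | succ k ih =>
      intro X
      rw [pow_succ, pow_succ, mul_assoc, mul_assoc]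
      refine le_trans ?_ (ih _)
      gcongr
      exact hgrow X
  -- Iterated growth by the factor `1 + δ` makes a power of `W` double every finite set.
  obtain ⟨k, hk⟩ := pow_unbounded_of_one_lt 2 (by linarith : 1 < 1 + δ)
  obtain ⟨X, hXlt⟩ := h.exists_card_mul_lt (W ^ k)
  have h1 := hpow k X
  have h2 : ((W ^ k * X).card : ℝ) < 2 * X.card := by exact_mod_cast hXlt
  have h3 : (2 : ℝ) * X.card ≤ (1 + δ) ^ k * X.card := by gcongr
  linarith

end Foelner

/-! ### The delta basis and composition operators on `l²` -/

section MagneticTranslations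

local notation "⟪" x ", " y "⟫" => inner ℂ x y

theorem ellTwo_inner_single {G : Type*} [DecidableEq G] (g : G) (f : ellTwo G) :
    ⟪(lp.single 2 g (1 : ℂ) : ellTwo G), f⟫ = f g := by
  have h := lp.inner_single_left (𝕜 := ℂ) (G := fun _ : G => ℂ) g 1 f
  rw [h]
  simp

/-- The Hilbert basis of `l²(G)^d` given by the delta functions. -/
noncomputable def deltaBasis (G : Type*) (d : ℕ) : HilbertBasis (Fin d × G) ℂ (ellTwoPow G d) := by
  classical
  exact HilbertBasis.mkOfOrthogonalEqBot
    (v := fun p => PiLp.single 2 p.1 (lp.single 2 p.2 (1 : ℂ) : ellTwo G))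
    (by
      rw [orthonormal_iff_ite]
      rintro ⟨i, g⟩ ⟨j, h⟩
      rw [PiLp.inner_apply, Finset.sum_eq_single i]
      · by_cases hij : i = j
        · subst hij
          rw [PiLp.single_eq_same, PiLp.single_eq_same, ellTwo_inner_single, lp.single_apply,
            Pi.single_apply]
          simp
        · simp [hij]
      · intro k _ hk
        simp [hk]
      · simp)
    (by
      rw [Submodule.eq_bot_iff]
      intro f hf
      ext j g
      have h := (Submodule.mem_orthogonal _ _).1 hf _ (Submodule.subset_span ⟨(j, g), rfl⟩)
      rw [PiLp.inner_apply, Finset.sum_eq_single j] at h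
      · rwa [PiLp.single_eq_same, ellTwo_inner_single] at h
      · intro k _ hk
        simp [hk]
      · simp)

theorem inner_deltaBasis {G : Type*} {d : ℕ} (j : Fin d) (g : G) (f : ellTwoPow G d) :
    ⟪deltaBasis G d (j, g), f⟫ = f j g := by
  classical
  rw [deltaBasis, HilbertBasis.coe_mkOfOrthogonalEqBot, PiLp.inner_apply,
    Finset.sum_eq_single j]
  · rw [PiLp.single_eq_same, ellTwo_inner_single]
  · intro k _ hk
    simp [hk]
  · simp

theorem hasSum_norm_sq_coord {G : Type*} {d : ℕ} (f : ellTwoPow G d) :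
    HasSum (fun p : Fin d × G => ‖f p.1 p.2‖ ^ 2) (‖f‖ ^ 2) := by
  have h := (deltaBasis G d).hasSum_inner_mul_inner f f
  rw [inner_self_eq_norm_sq_to_K] at h
  refine (Complex.hasSum_ofReal (f := fun p : Fin d × G => ‖f p.1 p.2‖ ^ 2)).1 ?_
  convert! h using 1
  · ext ⟨j, g⟩
    rw [← inner_conj_symm, inner_deltaBasis, Complex.conj_mul']
    norm_cast
  · norm_cast

theorem deltaBasis_apply_self {G : Type*} {d : ℕ} (j : Fin d) (g : G) :
    deltaBasis G d (j, g) j g = 1 := by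
  rw [← inner_deltaBasis, inner_self_eq_norm_sq_to_K, (deltaBasis G d).orthonormal.1]
  norm_num

theorem deltaBasis_apply_of_ne {G : Type*} {d : ℕ} {p q : Fin d × G} (h : p ≠ q) :
    deltaBasis G d p q.1 q.2 = 0 := by
  rw [← inner_deltaBasis]
  exact (deltaBasis G d).orthonormal.2 h.symm

/-- Composition with an injective map, as an operator of `l²`-spaces. -/
noncomputable def ellTwoComp {α β : Type*} (e : α → β) (he : Function.Injective e) :
    ellTwo β →L[ℂ] ellTwo α :=
  LinearMap.mkContinuous
    { toFun := fun f => ⟨fun a => f (e a), by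
        have h := (memℓp_gen_iff (p := 2) (by norm_num)).1 (lp.memℓp f)
        exact (memℓp_gen_iff (p := 2) (by norm_num)).2 (h.comp_injective he)⟩
      map_add' := fun f g => by ext; rfl
      map_smul' := fun c f => by ext; rfl } 1 fun f => by
    have h0 : (0 : ℝ) < (2 : ℝ≥0∞).toReal := by norm_num
    rw [one_mul, ← Real.rpow_le_rpow_iff (norm_nonneg _) (norm_nonneg _) h0,
      lp.norm_rpow_eq_tsum h0, lp.norm_rpow_eq_tsum h0]
    exact tsum_comp_le_tsum_of_inj ((memℓp_gen_iff (p := 2) (by norm_num)).1 (lp.memℓp f))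
      (fun a => by positivity) he

@[simp]
theorem ellTwoComp_apply {α β : Type*} (e : α → β) (he : Function.Injective e) (f : ellTwo β)
    (a : α) : ellTwoComp e he f a = f (e a) :=
  rfl

/-! ### Magnetic translations, coset restrictions and coordinate projections -/

variable {K : Subfield ℂ} {G : Type*} [Group G]

/-- The right magnetic translation `(R_g f)(x) = conj σ(x, g) f(xg)` on `l²(G)`. -/
noncomputable def rightTranslation (σ : Multiplier K G) (g : G) : ellTwo G ≃ₗᵢ[ℂ] ellTwo G :=
  LinearIsometryEquiv.ofSurjective
    { toFun := fun f => ⟨fun x => starRingEnd ℂ (σ x g : ℂ) * f (x * g),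
        ellTwo_memℓp_of_norm_eq (Equiv.mulRight g) f _ fun x => by simp [σ.norm_eq_one]⟩
      map_add' := fun f f' => by
        ext x
        exact mul_add _ _ _
      map_smul' := fun c f => by
        ext x
        exact mul_left_comm _ _ _
      norm_map' := fun f => by
        have h : (0 : ℝ) < (2 : ℝ≥0∞).toReal := by norm_num
        rw [← Real.rpow_left_inj (norm_nonneg _) (norm_nonneg _) h.ne', lp.norm_rpow_eq_tsum h,
          lp.norm_rpow_eq_tsum h,
          ← (Equiv.mulRight g).tsum_eq fun x => ‖f x‖ ^ (2 : ℝ≥0∞).toReal]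
        refine tsum_congr fun x => ?_
        simp [σ.norm_eq_one] }
    fun f => by
      refine ⟨⟨fun x => (σ (x * g⁻¹) g : ℂ) * f (x * g⁻¹),
        ellTwo_memℓp_of_norm_eq (Equiv.mulRight g⁻¹) f _ fun x => by simp [σ.norm_eq_one]⟩, ?_⟩
      ext x
      change starRingEnd ℂ (σ x g : ℂ) * ((σ (x * g * g⁻¹) g : ℂ) * f (x * g * g⁻¹)) = f x
      rw [mul_inv_cancel_right, ← mul_assoc, Complex.conj_mul', σ.norm_eq_one]
      norm_num

theorem rightTranslation_apply (σ : Multiplier K G) (g : G) (f : ellTwo G) (x : G) :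
    rightTranslation σ g f x = starRingEnd ℂ (σ x g : ℂ) * f (x * g) :=
  rfl

/-- The right magnetic translation on `l²(G)^d`. -/
noncomputable def rightTranslationPow (σ : Multiplier K G) (d : ℕ) (g : G) :
    ellTwoPow G d ≃ₗᵢ[ℂ] ellTwoPow G d :=
  LinearIsometryEquiv.piLpCongrRight 2 fun _ => rightTranslation σ g

theorem rightTranslationPow_apply (σ : Multiplier K G) (d : ℕ) (g : G) (f : ellTwoPow G d)
    (j : Fin d) (x : G) :
    rightTranslationPow σ d g f j x = starRingEnd ℂ (σ x g : ℂ) * f j (x * g) :=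
  rfl

theorem isProjectiveTranslation_rightTranslationPow (σ : Multiplier K G) (d : ℕ) :
    IsProjectiveTranslation (deltaBasis G d) (rightTranslationPow σ d) := by
  intro k j h
  refine ⟨starRingEnd ℂ (σ (h * k⁻¹) k : ℂ), by simp [σ.norm_eq_one], ?_⟩
  ext l x
  rw [rightTranslationPow_apply]
  change _ = starRingEnd ℂ (σ (h * k⁻¹) k : ℂ) * deltaBasis G d (j, h * k⁻¹) l x
  by_cases hx : (j, h * k⁻¹) = (l, x)
  · obtain ⟨rfl, rfl⟩ := Prod.mk.inj hx
    rw [inv_mul_cancel_right, deltaBasis_apply_self, deltaBasis_apply_self]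
  · have hx' : (j, h) ≠ (l, x * k) := fun h' => hx (by
      obtain ⟨rfl, rfl⟩ := Prod.mk.inj h'
      simp)
    rw [deltaBasis_apply_of_ne hx, deltaBasis_apply_of_ne hx', mul_zero, mul_zero]

theorem leftTranslation_apply (σ : Multiplier K G) (g : G) (f : ellTwo G) (x : G) :
    leftTranslation σ g f x = (σ g (g⁻¹ * x) : ℂ) * f (g⁻¹ * x) :=
  rfl

/-- This is the cocycle identity for `(g, g⁻¹x, h)`. The conjugates in the right translation act as
inverses, since `σ` has modulus one. -/
theorem leftTranslation_rightTranslation (σ : Multiplier K G) (g h : G) (f : ellTwo G) :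
    leftTranslation σ g (rightTranslation σ h f) =
      rightTranslation σ h (leftTranslation σ g f) := by
  ext x
  simp only [leftTranslation_apply, rightTranslation_apply]
  rw [mul_assoc g⁻¹ x h]
  have hc : (σ (g⁻¹ * x) h : ℂ) * σ g (g⁻¹ * x * h) = σ x h * σ g (g⁻¹ * x) := by
    have := congrArg (Subtype.val) (σ.cocycle g (g⁻¹ * x) h)
    simpa using this
  rw [mul_assoc g⁻¹ x h] at hc
  have e1 : starRingEnd ℂ (σ x h : ℂ) * σ x h = 1 := by
    rw [Complex.conj_mul', σ.norm_eq_one]; norm_num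
  have e2 : starRingEnd ℂ (σ (g⁻¹ * x) h : ℂ) * σ (g⁻¹ * x) h = 1 := by
    rw [Complex.conj_mul', σ.norm_eq_one]; norm_num
  linear_combination (-(f (g⁻¹ * (x * h))) * σ g (g⁻¹ * x) * starRingEnd ℂ (σ (g⁻¹ * x) h : ℂ)) * e1
    + (f (g⁻¹ * (x * h)) * starRingEnd ℂ (σ x h : ℂ) * σ g (g⁻¹ * (x * h))) * e2
    - (f (g⁻¹ * (x * h)) * starRingEnd ℂ (σ x h : ℂ) * starRingEnd ℂ (σ (g⁻¹ * x) h : ℂ)) * hc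

/-- The assignment `a ↦ ∑ a_g L_g` is additive. -/
noncomputable def TwistedGroupAlgebra.toOperatorHom (σ : Multiplier K G) :
    TwistedGroupAlgebra σ →+ ellTwo G →L[ℂ] ellTwo G where
  toFun a := a.toOperator
  map_zero' := Finsupp.sum_zero_index
  map_add' a b := Finsupp.sum_add_index' (M := K) (by simp) (by simp [add_smul])

theorem TwistedGroupAlgebra.toOperator_single (σ : Multiplier K G) (g : G) (c : K) :
    (TwistedGroupAlgebra.single σ g c).toOperator =
      (c : ℂ) • (leftTranslation σ g).toContinuousLinearMap :=
  Finsupp.sum_single_index (M := K) (by simp)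

theorem TwistedGroupAlgebra.toOperator_eq_sum {σ : Multiplier K G} (a : TwistedGroupAlgebra σ) :
    a.toOperator = ∑ g ∈ Finsupp.support (M := K) a,
      ((DFunLike.coe (F := G →₀ K) a g : K) : ℂ) • (leftTranslation σ g).toContinuousLinearMap :=
  rfl

theorem TwistedGroupAlgebra.toOperator_apply {σ : Multiplier K G} (a : TwistedGroupAlgebra σ)
    (f : ellTwo G) (x : G) :
    a.toOperator f x = Finsupp.sum (M := K) a fun g c =>
      (c : ℂ) * ((σ g (g⁻¹ * x) : ℂ) * f (g⁻¹ * x)) := by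
  rw [TwistedGroupAlgebra.toOperator_eq_sum, sum_apply, lp.coeFn_sum,
    Finset.sum_apply]
  rfl

theorem matrixOperator_apply {σ : Multiplier K G} {d : ℕ}
    (A : Matrix (Fin d) (Fin d) (TwistedGroupAlgebra σ)) (f : ellTwoPow G d) (i : Fin d) :
    matrixOperator A f i = ∑ j, (A i j).toOperator (f j) := by
  change (∑ j, (A i j).toOperator ∘L PiLp.proj 2 (fun _ : Fin d => ellTwo G) j) f = _
  rw [sum_apply]
  rfl

theorem matrixOperator_mem_unitaryCommutant {σ : Multiplier K G} {d : ℕ}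
    (A : Matrix (Fin d) (Fin d) (TwistedGroupAlgebra σ)) :
    matrixOperator A ∈ unitaryCommutant (rightTranslationPow σ d) := by
  refine mem_unitaryCommutant_iff.2 fun g f => ?_
  ext i : 1
  change _ = rightTranslation σ g (matrixOperator A f i)
  rw [matrixOperator_apply, matrixOperator_apply, map_sum]
  refine Finset.sum_congr rfl fun j _ => ?_
  change (A i j).toOperator (rightTranslation σ g (f j)) = _
  rw [TwistedGroupAlgebra.toOperator_eq_sum, sum_apply,
    sum_apply, map_sum]
  refine Finset.sum_congr rfl fun h _ => ?_
  change (_ : ℂ) • leftTranslation σ h (rightTranslation σ g (f j)) =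
    rightTranslation σ g ((_ : ℂ) • leftTranslation σ h (f j))
  rw [leftTranslation_rightTranslation, map_smul]

/-- The restriction of tuples of functions to a tuple of embedded copies of `α`. -/
noncomputable def ellTwoPowComp {α β : Type*} {n d : ℕ} (c : Fin n → Fin d) (e : Fin n → α → β)
    (he : ∀ j, Function.Injective (e j)) : ellTwoPow β d →L[ℂ] ellTwoPow α n :=
  (PiLp.continuousLinearEquiv 2 ℂ (fun _ : Fin n => ellTwo α)).symm.toContinuousLinearMap ∘L
    ContinuousLinearMap.pi fun j =>
      ellTwoComp (e j) (he j) ∘L PiLp.proj 2 (fun _ : Fin d => ellTwo β) (c j)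

theorem ellTwoPowComp_apply {α β : Type*} {n d : ℕ} (c : Fin n → Fin d) (e : Fin n → α → β)
    (he : ∀ j, Function.Injective (e j)) (f : ellTwoPow β d) (j : Fin n) :
    ellTwoPowComp c e he f j = ellTwoComp (e j) (he j) (f (c j)) :=
  rfl

theorem norm_ellTwoPowComp_le {α β : Type*} {n d : ℕ} (c : Fin n → Fin d) (e : Fin n → α → β)
    (he : ∀ j, Function.Injective (e j))
    (hinj : Function.Injective fun q : Fin n × α => (c q.1, e q.1 q.2)) :
    ‖ellTwoPowComp c e he‖ ≤ 1 := by
  refine ContinuousLinearMap.opNorm_le_bound _ zero_le_one fun f => ?_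
  rw [one_mul]
  refine le_of_sq_le_sq ?_ (norm_nonneg f)
  exact hasSum_le_inj _ hinj (fun _ _ => by positivity) (fun _ => le_rfl)
    (hasSum_norm_sq_coord (ellTwoPowComp c e he f)) (hasSum_norm_sq_coord f)

/-- The adjoint of a restriction is extension by zero along the embeddings, which is tested here by
pairing with an arbitrary `f`. -/
theorem adjoint_ellTwoPowComp_deltaBasis {α β : Type*} {n d : ℕ} (c : Fin n → Fin d)
    (e : Fin n → α → β) (he : ∀ j, Function.Injective (e j)) (j : Fin n) (a : α) :
    ContinuousLinearMap.adjoint (ellTwoPowComp c e he) (deltaBasis α n (j, a)) =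
      deltaBasis β d (c j, e j a) := by
  refine ext_inner_right ℂ fun f => ?_
  rw [ContinuousLinearMap.adjoint_inner_left, inner_deltaBasis, inner_deltaBasis,
    ellTwoPowComp_apply, ellTwoComp_apply]

/-- The projection of `l²(G)^d` onto the tuples supported in the set `F` of coordinates. -/
noncomputable def coordProj (G : Type*) {d : ℕ} (F : Finset (Fin d)) :
    ellTwoPow G d →L[ℂ] ellTwoPow G d :=
  (PiLp.continuousLinearEquiv 2 ℂ (fun _ : Fin d => ellTwo G)).symm.toContinuousLinearMap ∘L
    ContinuousLinearMap.pi fun j =>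
      if j ∈ F then PiLp.proj 2 (fun _ : Fin d => ellTwo G) j else 0

theorem coordProj_apply {G : Type*} {d : ℕ} (F : Finset (Fin d)) (f : ellTwoPow G d)
    (j : Fin d) : coordProj G F f j = if j ∈ F then f j else 0 := by
  change (if j ∈ F then PiLp.proj 2 (fun _ : Fin d => ellTwo G) j else 0 :
    ellTwoPow G d →L[ℂ] ellTwo G) f = _
  split_ifs <;> rfl

theorem coordProj_mem_unitaryCommutant (σ : Multiplier K G) {d : ℕ} (F : Finset (Fin d)) :
    coordProj G F ∈ unitaryCommutant (rightTranslationPow σ d) := by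
  refine mem_unitaryCommutant_iff.2 fun g f => ?_
  ext j : 1
  change _ = rightTranslation σ g (coordProj G F f j)
  rw [coordProj_apply, coordProj_apply, apply_ite (rightTranslation σ g), map_zero]
  rfl

theorem adjoint_coordProj {G : Type*} {d : ℕ} (F : Finset (Fin d)) :
    ContinuousLinearMap.adjoint (coordProj G F) = coordProj G F := by
  refine ((ContinuousLinearMap.eq_adjoint_iff _ _).2 fun f f' => ?_).symm
  rw [PiLp.inner_apply, PiLp.inner_apply]
  refine Finset.sum_congr rfl fun j _ => ?_
  rw [coordProj_apply, coordProj_apply]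
  split_ifs <;> simp

/-- Delta functions with coordinate in `F` are fixed by the self-adjoint `coordProj G F`, hence
orthogonal to its kernel; the others lie in the kernel. -/
theorem sum_norm_sq_ker_coordProj {d : ℕ} (F : Finset (Fin d)) :
    ∑ j, ‖(coordProj G F).ker.starProjection (deltaBasis G d (j, 1))‖ ^ 2 =
      (Fᶜ.card : ℝ) := by
  have h : ∀ j, (coordProj G F).ker.starProjection (deltaBasis G d (j, 1)) =
      if j ∈ F then 0 else deltaBasis G d (j, 1) := by
    intro j
    have hcoord : ∀ k l, coordProj G F (deltaBasis G d (j, k)) l =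
        if j ∈ F then deltaBasis G d (j, k) l else 0 := by
      intro k l
      rw [coordProj_apply]
      by_cases hl : l = j
      · rw [hl]
      · have : deltaBasis G d (j, k) l = 0 := by
          ext x
          exact deltaBasis_apply_of_ne (p := (j, k)) (q := (l, x))
            (fun h => hl (congrArg Prod.fst h).symm)
        simp [this]
    split_ifs with hj
    · rw [Submodule.starProjection_apply_eq_zero_iff, Submodule.mem_orthogonal]
      intro u hu
      have hu : coordProj G F u = 0 := hu
      have : coordProj G F (deltaBasis G d (j, 1)) = deltaBasis G d (j, 1) := by
        ext l : 1
        rw [hcoord, if_pos hj]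
      rw [← this, ← adjoint_coordProj, ContinuousLinearMap.adjoint_inner_right, hu,
        inner_zero_left]
    · rw [Submodule.starProjection_eq_self_iff]
      change coordProj G F (deltaBasis G d (j, 1)) = 0
      ext l : 1
      rw [hcoord, if_neg hj]
      rfl
  have hn : ∀ j, ‖(coordProj G F).ker.starProjection (deltaBasis G d (j, 1))‖ ^ 2 =
      if j ∈ Fᶜ then (1 : ℝ) else 0 := by
    intro j
    rw [h]
    by_cases hj : j ∈ F
    · simp [hj]
    · simp [hj, (deltaBasis G d).orthonormal.1]
  rw [Finset.sum_congr rfl fun j _ => hn j, Finset.sum_ite_mem]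
  simp

end MagneticTranslations

/-! ### Comparison of dimensions and compression to cosets -/

section Extension

open ContinuousLinearMap

local notation "⟪" x ", " y "⟫" => inner ℂ x y

/-- With `u = P_V Ψ* w` one has `‖u‖² = ⟪w, Ψ u⟫ = ⟪P_W w, Ψ u⟫`, and Cauchy–Schwarz applies. Summed
over a delta basis, this bounds the dimension of `V` seen through `Ψ` by that of `W`. -/
theorem norm_starProjection_adjoint_le {E E' : Type*} [NormedAddCommGroup E]
    [InnerProductSpace ℂ E] [CompleteSpace E] [NormedAddCommGroup E'] [InnerProductSpace ℂ E']
    [CompleteSpace E'] {Ψ : E →L[ℂ] E'} (hΨ : ‖Ψ‖ ≤ 1) {V : Submodule ℂ E} {W : Submodule ℂ E'}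
    [V.HasOrthogonalProjection] [W.HasOrthogonalProjection] (h : ∀ v ∈ V, Ψ v ∈ W) (w : E') :
    ‖V.starProjection (adjoint Ψ w)‖ ≤ ‖W.starProjection w‖ := by
  set u := V.starProjection (adjoint Ψ w) with hu
  have huV : u ∈ V := V.starProjection_apply_mem _
  have h1 : ⟪u, u⟫ = ⟪W.starProjection w, Ψ u⟫ := by
    have e1 := Submodule.starProjection_inner_eq_zero (adjoint Ψ w) u huV
    have e2 := Submodule.starProjection_inner_eq_zero w (Ψ u) (h u huV)
    rw [inner_sub_left, sub_eq_zero] at e1 e2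
    exact e1.symm.trans ((adjoint_inner_left _ _ _).trans e2)
  have h2 : ‖u‖ * ‖u‖ ≤ ‖W.starProjection w‖ * ‖u‖ := by
    rw [← inner_self_eq_norm_mul_norm (𝕜 := ℂ), h1]
    refine (RCLike.re_le_norm _).trans ((norm_inner_le_norm _ _).trans ?_)
    gcongr
    simpa using Ψ.le_of_opNorm_le hΨ u
  rcases (norm_nonneg u).eq_or_lt with h0 | h0
  · rw [← h0]
    exact norm_nonneg _
  · exact le_of_mul_le_mul_right h2 h0

/-- The dimension of the space of the vectors mapped by an injective invariant operator to the
vectors supported in `F` is the cardinality of `F`. -/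
theorem sum_norm_sq_ker_coordProj_mul {K : Subfield ℂ} {G : Type*} [Group G]
    (σ : Multiplier K G) {d : ℕ} {D : ellTwoPow G d →L[ℂ] ellTwoPow G d}
    (hD : D ∈ unitaryCommutant (rightTranslationPow σ d)) (hker : D.ker = ⊥)
    (F : Finset (Fin d)) :
    ∑ j, ‖(coordProj G Fᶜ * D).ker.starProjection (deltaBasis G d (j, 1))‖ ^ 2 =
      (F.card : ℝ) := by
  have hb := isProjectiveTranslation_rightTranslationPow σ d
  -- The adjoint is `D*` after the coordinate projection, and `D*` is injective along with `D`. The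
  -- dimension can thus be computed on the adjoint side.
  have hadj : (adjoint (coordProj G Fᶜ * D)).ker = (coordProj G Fᶜ).ker := by
    have h := ker_adjoint_eq_bot hb hD hker
    ext v
    rw [LinearMap.mem_ker, LinearMap.mem_ker]
    have : adjoint (coordProj G Fᶜ * D) v = adjoint D (coordProj G Fᶜ v) := by
      change adjoint (coordProj G Fᶜ ∘L D) v = _
      rw [adjoint_comp, adjoint_coordProj]
      rfl
    change adjoint (coordProj G Fᶜ * D) v = 0 ↔ coordProj G Fᶜ v = 0
    rw [this]
    refine ⟨fun hv => ?_, fun hv => by rw [hv, map_zero]⟩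
    exact (Submodule.eq_bot_iff _).1 h _ hv
  rw [← sum_norm_sq_ker_adjoint hb (mul_mem (coordProj_mem_unitaryCommutant σ Fᶜ) hD)]
  simp only [hadj]
  rw [sum_norm_sq_ker_coordProj, compl_compl]

theorem hasEigenvalue_iff_ker_ne_bot {E : Type*} [NormedAddCommGroup E] [NormedSpace ℂ E]
    (T : E →L[ℂ] E) (z : ℂ) :
    Module.End.HasEigenvalue (T : Module.End ℂ E) z ↔ (T - z • 1).ker ≠ ⊥ := by
  rw [Module.End.hasEigenvalue_iff]
  have : Module.End.eigenspace (T : Module.End ℂ E) z = (T - z • 1).ker := by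
    ext v
    rw [Module.End.mem_eigenspace_iff, LinearMap.mem_ker]
    change T v = z • v ↔ T v - z • v = 0
    rw [sub_eq_zero]
  rw [this]

variable {K : Subfield ℂ} {H G Q : Type*} [Group H] [Group G] [Group Q]

open Classical in
/-- The element of the group algebra of `H` describing the part of the action of `a` which maps
functions on the coset `s x' H` to functions on the coset `s x H`. -/
noncomputable def cosetCompression (i : H →* G) (p : G →* Q) (s : Q → G) (σ' : Multiplier K Q)
    (a : TwistedGroupAlgebra (Multiplier.pullback p σ')) (x x' : Q) :
    TwistedGroupAlgebra (Multiplier.trivial K H) :=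
  ∑ g ∈ Finsupp.support (M := K) a,
    if p g * x' = x then
      -- For `h` in `H` the pulled back multiplier at `(g, s x' h)` is `σ' (p g) x'`, independent of
      -- `h`, so it is absorbed into the coefficient. When `s` is a section of `p` and the sequence
      -- is exact, `(s x)⁻¹ g s x'` lies in the range of `i`, so the default value of `invFun` never
      -- enters.
      TwistedGroupAlgebra.single _ (Function.invFun i ((s x)⁻¹ * g * s x'))
        (DFunLike.coe (F := G →₀ K) a g * σ' (p g) x')
    else 0

open Classical in
theorem cosetCompression_toOperator_apply {i : H →* G} {p : G →* Q} (hexact : i.range = p.ker)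
    {s : Q → G} (hs : ∀ x, p (s x) = x) (σ' : Multiplier K Q)
    (a : TwistedGroupAlgebra (Multiplier.pullback p σ')) (x x' : Q)
    (hinj : Function.Injective fun h => s x' * i h) (f : ellTwo G) (h : H) :
    (cosetCompression i p s σ' a x x').toOperator (ellTwoComp (fun h => s x' * i h) hinj f) h =
      ∑ g ∈ Finsupp.support (M := K) a, if p g * x' = x then
        ((DFunLike.coe (F := G →₀ K) a g : K) : ℂ) *
          ((σ' (p g) x' : ℂ) * f (g⁻¹ * (s x * i h))) else 0 := by
  change TwistedGroupAlgebra.toOperatorHom _ (cosetCompression i p s σ' a x x') _ h = _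
  rw [cosetCompression, map_sum, sum_apply, lp.coeFn_sum, Finset.sum_apply]
  refine Finset.sum_congr rfl fun g _ => ?_
  split_ifs with hg
  · have hmem : (s x)⁻¹ * g * s x' ∈ i.range := by
      rw [hexact, MonoidHom.mem_ker]
      simp [hs, ← hg]
    have hk : i (Function.invFun i ((s x)⁻¹ * g * s x')) = (s x)⁻¹ * g * s x' :=
      Function.invFun_eq hmem
    change (TwistedGroupAlgebra.single _ _ _).toOperator _ h = _
    rw [TwistedGroupAlgebra.toOperator_single]
    change ((_ * _ : K) : ℂ) * leftTranslation _ _ _ h = _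
    rw [leftTranslation_apply, ellTwoComp_apply, map_mul, map_inv, hk]
    have : s x' * (((s x)⁻¹ * g * s x')⁻¹ * i h) = g⁻¹ * (s x * i h) := by group
    rw [this]
    simp [Multiplier.trivial, mul_assoc]
  · rw [map_zero]
    rfl

/-- At an interior point `x` every coset from which `a` reaches `s x H` lies over `X`, so truncation
to `X` loses nothing. -/
theorem sum_cosetCompression_toOperator_apply {i : H →* G} {p : G →* Q}
    (hexact : i.range = p.ker) {s : Q → G} (hs : ∀ x, p (s x) = x) (σ' : Multiplier K Q)
    (a : TwistedGroupAlgebra (Multiplier.pullback p σ')) (X : Finset Q) (x : Q)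
    (hx : ∀ g ∈ Finsupp.support (M := K) a, (p g)⁻¹ * x ∈ X)
    (hinj : ∀ x', Function.Injective fun h => s x' * i h) (f : ellTwo G) (h : H) :
    ∑ x' ∈ X, (cosetCompression i p s σ' a x x').toOperator
      (ellTwoComp (fun h => s x' * i h) (hinj x') f) h = a.toOperator f (s x * i h) := by
  classical
  have hpi : p (i h) = 1 := by
    rw [← MonoidHom.mem_ker, ← hexact]
    exact ⟨h, rfl⟩
  simp only [cosetCompression_toOperator_apply hexact hs]
  rw [Finset.sum_comm, TwistedGroupAlgebra.toOperator_apply]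
  refine Finset.sum_congr rfl fun g hg => ?_
  rw [Finset.sum_eq_single ((p g)⁻¹ * x)]
  · rw [if_pos (mul_inv_cancel_left _ _)]
    simp [Multiplier.pullback, hs, hpi]
  · intro y _ hy
    exact if_neg fun h' => hy (by rw [← h', inv_mul_cancel_left])
  · exact fun h' => absurd (hx g hg) h'

end Extension

/-! ### The dimension count on a Følner set -/

open ContinuousLinearMap (adjoint) in
theorem theorem6p2 {H G Q : Type*} [Group H] [Group G] [Group Q]
    (i : H →* G) (p : G →* Q)
    (hi : Function.Injective i) (hexact : i.range = p.ker) (hp : Function.Surjective p)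
    (hfg : Group.FG Q) (hamen : IsAmenableGroup Q)
    (σ' : Multiplier algebraicNumbers Q)
    (hH : HasAlgebraicEigenvalueProperty H) :
    HasMultiplierAlgebraicEigenvalueProperty (Multiplier.pullback p σ') := by
  classical
  intro d A z hz
  by_contra halg
  rw [hasEigenvalue_iff_ker_ne_bot] at hz
  set D := matrixOperator A - z • 1 with hDdef
  have hD : D ∈ unitaryCommutant (rightTranslationPow (Multiplier.pullback p σ') d) :=
    sub_mem (matrixOperator_mem_unitaryCommutant A) (SMulMemClass.smul_mem z (one_mem _))
  have hb := isProjectiveTranslation_rightTranslationPow (Multiplier.pullback p σ') d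
  set t : ℝ := ∑ j, ‖D.ker.starProjection (deltaBasis G d (j, 1))‖ ^ 2 with ht
  have htpos : 0 < t := lt_of_le_of_ne (Finset.sum_nonneg fun j _ => by positivity)
    fun h => hz ((ker_eq_bot_iff_sum_norm_sq hb hD).2 h.symm)
  -- The choice of `ε` gives `|Y| (d + 1) < t |X|`, to contradict `|X| t ≤ |Y| d`.
  obtain ⟨X, hX⟩ := hamen.exists_foelner
    ((Finset.univ.biUnion fun j : Fin d × Fin d =>
      Finsupp.support (M := algebraicNumbers) (A j.1 j.2)).image p)
    (div_pos htpos (by positivity : (0 : ℝ) < d + 1))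
  set Y := X.filter fun x => ∃ q ∈ (Finset.univ.biUnion fun j : Fin d × Fin d =>
      Finsupp.support (M := algebraicNumbers) (A j.1 j.2)).image p, q⁻¹ * x ∉ X with hY
  let s : Q → G := Function.surjInv hp
  have hs : ∀ x, p (s x) = x := Function.surjInv_eq hp
  have hinj : ∀ x, Function.Injective fun h => s x * i h := fun x =>
    (mul_right_injective (s x)).comp hi
  have hpi : ∀ h, p (i h) = 1 := fun h => by
    rw [← MonoidHom.mem_ker, ← hexact]
    exact ⟨h, rfl⟩
  let n := Fintype.card (X × Fin d)
  let e : Fin n ≃ X × Fin d := (Fintype.equivFin _).symm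
  let Ψ : ellTwoPow G d →L[ℂ] ellTwoPow H n :=
    ellTwoPowComp (fun j => (e j).2) (fun j h => s (e j).1 * i h) (fun j => hinj _)
  have hΨ : ‖Ψ‖ ≤ 1 := by
    refine norm_ellTwoPowComp_le _ _ _ ?_
    rintro ⟨j, h⟩ ⟨k, h'⟩ hjk
    obtain ⟨h1, h2⟩ := Prod.mk.inj hjk
    have h3 : ((e j).1 : Q) = (e k).1 := by
      have := congrArg p h2
      simpa [hs, hpi] using this
    obtain rfl : j = k := e.injective (Prod.ext (Subtype.ext h3) h1)
    have h4 : h = h' := hinj _ h2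
    rw [h4]
  let B : Matrix (Fin n) (Fin n) (TwistedGroupAlgebra (Multiplier.trivial algebraicNumbers H)) :=
    fun j k => cosetCompression i p s σ' (A (e j).2 (e k).2) (e j).1 (e k).1
  set D' := matrixOperator B - z • 1 with hD'def
  have hD' : D' ∈ unitaryCommutant
      (rightTranslationPow (Multiplier.trivial algebraicNumbers H) n) :=
    sub_mem (matrixOperator_mem_unitaryCommutant B) (SMulMemClass.smul_mem z (one_mem _))
  -- The eigenvalue property of `H` enters here: a transcendental `z` is not an eigenvalue of `B`.
  have hker : D'.ker = ⊥ := by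
    by_contra h
    exact halg (hH n B z ((hasEigenvalue_iff_ker_ne_bot _ _).2 h))
  let F : Finset (Fin n) := Finset.univ.filter fun j => ((e j).1 : Q) ∈ Y
  -- Over cosets outside the boundary, `B (Ψ f)` agrees with the restriction of `A f = z f`, so `D'
  -- (Ψ f)` lives on the coordinates in `F`.
  have hmaps : ∀ f ∈ D.ker, Ψ f ∈ (coordProj H Fᶜ * D').ker := by
    intro f hf
    have hf : matrixOperator A f = z • f := sub_eq_zero.1 hf
    change coordProj H Fᶜ (matrixOperator B (Ψ f) - z • Ψ f) = 0
    ext j h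
    rw [coordProj_apply]
    split_ifs with hj
    · have hint : ((e j).1 : Q) ∉ Y := by simpa [F] using hj
      have hx : ∀ l, ∀ g ∈ Finsupp.support (M := algebraicNumbers) (A (e j).2 l),
          (p g)⁻¹ * ((e j).1 : Q) ∈ X := by
        intro l g hg
        by_contra hgX
        refine hint (Finset.mem_filter.2 ⟨(e j).1.2, p g, Finset.mem_image_of_mem _ ?_, hgX⟩)
        exact Finset.mem_biUnion.2 ⟨((e j).2, l), Finset.mem_univ _, hg⟩
      have h1 : matrixOperator B (Ψ f) j h = matrixOperator A f (e j).2 (s (e j).1 * i h) := by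
        rw [matrixOperator_apply, matrixOperator_apply, lp.coeFn_sum, lp.coeFn_sum,
          Finset.sum_apply, Finset.sum_apply, ← e.symm.sum_comp, Fintype.sum_prod_type_right]
        refine Finset.sum_congr rfl fun l _ => ?_
        rw [← sum_cosetCompression_toOperator_apply hexact hs σ' (A (e j).2 l) X _ (hx l) hinj,
          ← Finset.sum_coe_sort X]
        refine Finset.sum_congr rfl fun x _ => ?_
        simp only [B, Ψ, ellTwoPowComp_apply, Equiv.apply_symm_apply]
      change matrixOperator B (Ψ f) j h - z * f (e j).2 (s (e j).1 * i h) = 0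
      rw [h1, hf]
      exact sub_self _
    · rfl
  have hle : ∑ j, ‖D.ker.starProjection (adjoint Ψ (deltaBasis H n (j, 1)))‖ ^ 2 ≤
      (F.card : ℝ) := by
    rw [← sum_norm_sq_ker_coordProj_mul _ hD' hker F]
    refine Finset.sum_le_sum fun j _ => ?_
    gcongr
    exact norm_starProjection_adjoint_le hΨ hmaps _
  -- The adjoint of `Ψ` sends `δ_(j,1)` to a delta function at a coset representative. By
  -- translation invariance it may be moved to the identity, so each element of `X` contributes
  -- exactly `t`.
  have hleft : ∑ j, ‖D.ker.starProjection (adjoint Ψ (deltaBasis H n (j, 1)))‖ ^ 2 =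
      X.card * t := by
    have : ∀ j, ‖D.ker.starProjection (adjoint Ψ (deltaBasis H n (j, 1)))‖ ^ 2 =
        ‖D.ker.starProjection (deltaBasis G d ((e j).2, 1))‖ ^ 2 := by
      intro j
      rw [adjoint_ellTwoPowComp_deltaBasis,
        norm_apply_translate hb (ker_starProjection_mem_unitaryCommutant hD)]
    simp only [this]
    rw [e.sum_comp fun q => ‖D.ker.starProjection (deltaBasis G d (q.2, 1))‖ ^ 2,
      Fintype.sum_prod_type]
    simp [ht]
  have hF : F.card = Y.card * d := by
    have h1 : F.card = (Y ×ˢ (Finset.univ : Finset (Fin d))).card := by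
      refine Finset.card_bij (fun j _ => (((e j).1 : Q), (e j).2)) ?_ ?_ ?_
      · intro j hj
        simpa [F] using hj
      · intro j _ k _ hjk
        obtain ⟨h1, h2⟩ := Prod.mk.inj hjk
        exact e.injective (Prod.ext (Subtype.ext h1) h2)
      · rintro ⟨x, l⟩ hx
        have hxY : x ∈ Y := (Finset.mem_product.1 hx).1
        exact ⟨e.symm (⟨x, (Finset.mem_filter.1 hxY).1⟩, l), by simpa [F] using hxY, by simp⟩
    rw [h1, Finset.card_product, Finset.card_univ, Fintype.card_fin]
  rw [hleft, hF, Nat.cast_mul] at hle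
  rw [div_mul_eq_mul_div, lt_div_iff₀ (by positivity)] at hX
  have := Nat.cast_nonneg (α := ℝ) Y.card
  nlinarith
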